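/- Let $n=2^k$ be a power of two. The $n$-input FFT DAG has as nodes the pairs $\langle w,l\rangle$ with $0\le w<n$, $0\le l\le \log n$ (all logarithms are to base two), and an arc from $\langle w,l\rangle$ to $\langle w',l'\rangle$ if and only if $l'=l+1$ and either $w=w'$ or the binary representations of $w$ and $w'$ differ exactly in the $l'$-th least significant bit. Its inputs are the nodes of in-degree $0$ and its outputs the nodes of out-degree $0$. A BSP with $p$ processors, each with unbounded local memory, executes a finite sequence of supersteps. In a superstep each processor first performs local operations and then sends messages, which become visible to their receivers at the beginning of the next superstep; a message carries at most one datum (one raw input or the value of one node). A processor can evaluate an input node only if it holds the corresponding raw input, and any other node only if it holds the values of all its predecessors; it can send only data that it holds. The execution evaluates the DAG without recomputation if each node is evaluated exactly once, by one processor. The degree of a superstep is the maximum, over the processors, of the number of messages sent and of the number of messages received by the processor in that superstep, and the BSP communication complexity $H$ is the sum of the degrees of all supersteps. Let $\mathcal A$ be any algorithm that evaluates the $n$-input FFT DAG without recomputation on a BSP with $p\le 2n/e$ processors, such that initially each input is available to exactly one processor, and let $q$ be the maximum number of output nodes evaluated by a processor. Then the BSP communication complexity of $\mathcal A$ satisfies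 \[ H_{\mathcal A}\;\ge\;\frac{n\log\bigl(n/(8q^2)\bigr)}{4p\log(2n/p)}+\frac{\min\{q,n-q\}}{4}. \] Moreover, if $q\le n/2$, then \[ H_{\mathcal A}\;>\;\frac{n\log(n/2)}{8p\log(2n/p)}. \] -/

import Mathlib

/-- A computation DAG: `arc u v` says that the value of `u` is an operand of `v`. -/
structure ComputationDAG (V : Type*) where
  arc : V → V → Prop
  acyclic : ∀ v, ¬ Relation.TransGen arc v v

namespace ComputationDAG

variable {V : Type*}

/-- Inputs are the nodes of in-degree zero. -/
def IsInput (G : ComputationDAG V) (v : V) : Prop := ∀ u, ¬ G.arc u v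

/-- Outputs are the nodes of out-degree zero. -/
def IsOutput (G : ComputationDAG V) (v : V) : Prop := ∀ w, ¬ G.arc v w

end ComputationDAG

/-! ### The FFT DAG on `2 ^ k` inputs -/

/-- A node is a pair `⟨w, l⟩` with `0 ≤ w < 2 ^ k` and `0 ≤ l ≤ k`. -/
abbrev FFTNode (k : ℕ) : Type := Fin (2 ^ k) × Fin (k + 1)

/-- Arcs go from `⟨w, l⟩` to `⟨w', l + 1⟩` where `w = w'`, or `w` and `w'` differ exactly in the
`(l + 1)`-th least significant bit, which `Nat.testBit` (counting from zero) numbers `l`. -/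
def FFTArc (k : ℕ) (a b : FFTNode k) : Prop :=
  (b.2 : ℕ) = (a.2 : ℕ) + 1 ∧
    (a.1 = b.1 ∨
      ∀ i : ℕ, (a.1 : ℕ).testBit i ≠ (b.1 : ℕ).testBit i ↔ i = (a.2 : ℕ))

theorem FFTArc.level_lt_of_transGen {k : ℕ} {a b : FFTNode k}
    (h : Relation.TransGen (FFTArc k) a b) : (a.2 : ℕ) < (b.2 : ℕ) := by
  induction h with
  | single h => have := h.1; omega
  | tail _ h ih => have := h.1; omega

def fftDAG (k : ℕ) : ComputationDAG (FFTNode k) where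
  arc := FFTArc k
  acyclic := fun _ h => lt_irrefl _ (FFTArc.level_lt_of_transGen h)

/-! ### Evaluation of a computation DAG on a BSP with `p` processors -/

namespace BSP

/-- The data of an execution that concern the DAG: the raw datum on which the input operation of
an input node acts, and the value of a node once it has been evaluated. -/
inductive Word (V : Type*) where
  | raw (v : V) : Word V
  | val (v : V) : Word V

/-- A message carries at most one such word; `none` stands for a message that has nothing to do
with the DAG (it still counts as a message). -/
structure Message (p : ℕ) (V : Type*) where
  src : Fin p
  dst : Fin p
  payload : Option (Word V)

/-- One superstep: the nodes evaluated by each processor, in the order of evaluation, and then the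
messages sent. -/
structure Superstep (p : ℕ) (V : Type*) where
  ops : Fin p → List V
  msgs : List (Message p V)

/-- The contents of the (unbounded) local memories. -/
abbrev Memory (p : ℕ) (V : Type*) : Type _ := Fin p → Set (Word V)

section

variable {p : ℕ} {V : Type*}

/-- Node `v` can be evaluated by a processor with memory `M`: an input node needs its raw datum, any
other node needs the values of all its predecessors. -/
def CanEvaluate (G : ComputationDAG V) (M : Set (Word V)) (v : V) : Prop :=
  (G.IsInput v → Word.raw v ∈ M) ∧ ∀ u, G.arc u v → Word.val u ∈ M

/-- The nodes of the list can be evaluated one after the other, starting with memory `M`. -/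
def LocalValid (G : ComputationDAG V) (M : Set (Word V)) : List V → Prop
  | [] => True
  | v :: vs => CanEvaluate G M v ∧ LocalValid G (insert (Word.val v) M) vs

namespace Superstep

/-- The memories after the local computation of the superstep. -/
def afterOps (s : Superstep p V) (M : Memory p V) : Memory p V :=
  fun P => M P ∪ {x | ∃ v ∈ s.ops P, x = Word.val v}

/-- The memories at the beginning of the next superstep, when the messages have become visible. -/
def next (s : Superstep p V) (M : Memory p V) : Memory p V :=
  fun P => s.afterOps M P ∪ {x | ∃ m ∈ s.msgs, m.dst = P ∧ m.payload = some x}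

/-- The superstep can be executed from `M`: operands are in the local memory of the processor
that uses them, and a processor sends only words that it has. -/
def Valid (G : ComputationDAG V) (s : Superstep p V) (M : Memory p V) : Prop :=
  (∀ P, LocalValid G (M P) (s.ops P)) ∧
    ∀ m ∈ s.msgs, ∀ x, m.payload = some x → x ∈ s.afterOps M m.src

/-- The degree: the maximum number of messages sent or received by any processor. -/
def degree (s : Superstep p V) : ℕ :=
  Finset.univ.sup fun P : Fin p =>
    max (s.msgs.countP fun m => m.src = P) (s.msgs.countP fun m => m.dst = P)

end Superstep

/-- The supersteps of the list can be executed one after the other, starting from `M`. -/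
def ValidFrom (G : ComputationDAG V) : Memory p V → List (Superstep p V) → Prop
  | _, [] => True
  | M, s :: ss => s.Valid G M ∧ ValidFrom G (s.next M) ss

end

/-- An execution of a BSP algorithm: `avail P v` says that the raw datum of the input node `v` is
initially available to processor `P`. -/
structure Execution (p : ℕ) (V : Type*) where
  avail : Fin p → V → Prop
  steps : List (Superstep p V)

namespace Execution

variable {p : ℕ} {V : Type*}

def initialMemory (A : Execution p V) : Memory p V :=
  fun P => {x | ∃ v, A.avail P v ∧ x = Word.raw v}

/-- The BSP communication complexity: the sum of the degrees of the supersteps. -/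
def commComplexity (A : Execution p V) : ℕ := (A.steps.map Superstep.degree).sum

/-- How many times node `v` is evaluated, over all supersteps and processors. -/
def evalCount [DecidableEq V] (A : Execution p V) (v : V) : ℕ :=
  (A.steps.map fun s => ∑ P : Fin p, (s.ops P).count v).sum

/-- The execution respects the dependencies of `G` and evaluates every node, possibly with
recomputation. -/
def Evaluates [DecidableEq V] (A : Execution p V) (G : ComputationDAG V) : Prop :=
  ValidFrom G A.initialMemory A.steps ∧ ∀ v, 1 ≤ A.evalCount v

/-- Every node is evaluated exactly once. -/
def EvaluatesWithoutRecomputation [DecidableEq V] (A : Execution p V) (G : ComputationDAG V) :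
    Prop :=
  A.Evaluates G ∧ ∀ v, A.evalCount v = 1

/-- Every input of `G` is initially available to exactly one processor. -/
def InputsAtUniqueProcessor (A : Execution p V) (G : ComputationDAG V) : Prop :=
  ∀ v, G.IsInput v → ∃! P, A.avail P v

/-- The set of output nodes of `G` evaluated by processor `P`. -/
def outputsOf (A : Execution p V) (G : ComputationDAG V) (P : Fin p) : Set V :=
  {v | G.IsOutput v ∧ ∃ s ∈ A.steps, v ∈ s.ops P}

/-- The maximum number of output nodes evaluated by a processor. -/
noncomputable def maxOutputs (A : Execution p V) (G : ComputationDAG V) : ℕ :=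
  Finset.univ.sup fun P : Fin p => (A.outputsOf G P).ncard

end Execution

end BSP

/-! Attach two packets to each row of level `0`, one per outgoing arc, and let every row of the
levels `1, …, k - 1` be a switch, which passes its two packets on straight or exchanged. The
`2 ^ (n * log (n / 2))` settings, with binary `log`, route the `2 * n` packets differently. Let the
packets travel with the values of the nodes whose arcs they use. When and where values move is
fixed by the execution, so in a superstep of degree `h` the packets that move are determined by the
choice of one packet for each moving arc, at most `2 * h` from each processor; by concavity of the
logarithm this multiplies the number of possible allocations of packets to processors by at most
`(2 * n / p) ^ (2 * h * p)`. At the end a processor holds at most `2 * q` packets, so an allocation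
leaves at most `(2 * q) ^ (2 * n)` routings, and
`n * log (n / 2) ≤ 2 * H * p * log (2 * n / p) + 2 * n * log (2 * q)`.

On the other hand, for each `x` the paths from row `w` of level `0` to row `w ^^^ x` of level `k`
are disjoint. Averaging over `x` the number of those that leave or enter the processor with `q`
outputs gives `min q (n - q) / 2 ≤ H`.

The mean of the two bounds is the first claim. For the second, either `q / 2 ≤ H` is already
enough, or `q` is so small that the first bound is: `n ≤ p * q` then forces
`log (2 * q) ≤ log (n / 2) / 4`. -/

open Finset

theorem existsUnique_ne_zero_of_sum_eq_one {ι : Type*} {s : Finset ι} {f : ι → ℕ}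
    (h : ∑ i ∈ s, f i = 1) : ∃! i, i ∈ s ∧ f i ≠ 0 := by
  classical
  obtain ⟨i, hi, hfi⟩ := exists_ne_zero_of_sum_ne_zero (h.trans_ne one_ne_zero)
  refine ⟨i, ⟨hi, hfi⟩, fun j ⟨hj, hfj⟩ => ?_⟩
  have hrest : ∑ j ∈ s.erase i, f j = 0 := by
    have := add_sum_erase s f hi
    omega
  by_contra hne
  exact hfj (sum_eq_zero_iff.1 hrest j (mem_erase.2 ⟨hne, hj⟩))

theorem exists_lt_and_not_succ {c : ℕ → Prop} {d : ℕ} (h0 : c 0) (hd : ¬ c d) :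
    ∃ t < d, c t ∧ ¬ c (t + 1) := by
  by_contra! hstay
  have hc : ∀ t ≤ d, c t := fun t => t.rec (fun _ => h0)
    fun t ih ht => hstay t ht (ih (Nat.le_of_succ_le ht))
  exact hd (hc d le_rfl)

namespace BSP

variable {p : ℕ} {V : Type*} {G : ComputationDAG V}

theorem LocalValid.val_mem_or_mem {u v : V} (huv : G.arc u v) {vs : List V} {M : Set (Word V)}
    (h : LocalValid G M vs) (hv : v ∈ vs) : Word.val u ∈ M ∨ u ∈ vs := by
  induction vs generalizing M with
  | nil => exact absurd hv List.not_mem_nil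
  | cons a vs ih =>
    rcases List.mem_cons.1 hv with rfl | hv
    · exact Or.inl (h.1.2 u huv)
    · rcases ih h.2 hv with hu | hu
      · rcases Set.mem_insert_iff.1 hu with hua | hu
        · exact Or.inr (Word.val.inj hua ▸ List.mem_cons_self)
        · exact Or.inl hu
      · exact Or.inr (List.mem_cons_of_mem _ hu)

namespace Superstep

/-- The superstep without operations and messages, by which executions are continued beyond their
last superstep so that supersteps and memories are indexed by all natural numbers. -/
def idle : Superstep p V := ⟨fun _ => [], []⟩

/-- `s.Sends u P Q`: a message of the superstep carries the value of `u` from `P` to `Q`. -/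
def Sends (s : Superstep p V) (u : V) (P Q : Fin p) : Prop :=
  ∃ m ∈ s.msgs, m.src = P ∧ m.dst = Q ∧ m.payload = some (Word.val u)

theorem countP_src_le_degree (s : Superstep p V) (P : Fin p) :
    (s.msgs.countP fun m => m.src = P) ≤ s.degree :=
  (le_max_left _ _).trans (le_sup (f := fun P : Fin p =>
    max (s.msgs.countP fun m => m.src = P) (s.msgs.countP fun m => m.dst = P)) (mem_univ P))

theorem countP_dst_le_degree (s : Superstep p V) (P : Fin p) :
    (s.msgs.countP fun m => m.dst = P) ≤ s.degree :=
  (le_max_right _ _).trans (le_sup (f := fun P : Fin p =>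
    max (s.msgs.countP fun m => m.src = P) (s.msgs.countP fun m => m.dst = P)) (mem_univ P))

end Superstep

theorem card_le_countP_of_forall_exists_payload {S : Finset V} {ms : List (Message p V)}
    {r : Message p V → Prop} [DecidablePred r]
    (hS : ∀ u ∈ S, ∃ m ∈ ms, r m ∧ m.payload = some (Word.val u)) :
    #S ≤ ms.countP fun m => r m := by
  classical
  have hinj : Function.Injective fun u : V => some (Word.val u) := fun u v h =>
    Word.val.inj (Option.some.inj h)
  calc #S = #(S.image fun u => some (Word.val u)) := (card_image_of_injective S hinj).symm
    _ ≤ #((ms.filter fun m => r m).map Message.payload).toFinset := by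
        refine card_le_card (image_subset_iff.2 fun u hu => ?_)
        obtain ⟨m, hm, hr, hpay⟩ := hS u hu
        rw [List.mem_toFinset, ← hpay]
        exact List.mem_map_of_mem (List.mem_filter.2 ⟨hm, decide_eq_true hr⟩)
    _ ≤ ((ms.filter fun m => r m).map Message.payload).length := List.toFinset_card_le _
    _ = ms.countP fun m => r m := by rw [List.length_map, List.countP_eq_length_filter]

theorem Superstep.card_le_degree_of_sends {s : Superstep p V} {S : Finset V} {P : Fin p}
    (hS : ∀ u ∈ S, ∃ Q, s.Sends u P Q) : #S ≤ s.degree := by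
  refine (card_le_countP_of_forall_exists_payload fun u hu => ?_).trans (s.countP_src_le_degree P)
  obtain ⟨Q, m, hm, hsrc, -, hpay⟩ := hS u hu
  exact ⟨m, hm, hsrc, hpay⟩

/-- The memories before superstep `t` when the supersteps `ss`, and then idle ones, are executed
from `M`. -/
def memoryAfter (M : Memory p V) (ss : List (Superstep p V)) : ℕ → Memory p V
  | 0 => M
  | t + 1 => (ss.getD t Superstep.idle).next (memoryAfter M ss t)

theorem memoryAfter_cons_succ (M : Memory p V) (s : Superstep p V) (ss : List (Superstep p V))
    (t : ℕ) : memoryAfter M (s :: ss) (t + 1) = memoryAfter (s.next M) ss t := by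
  induction t with
  | zero => rfl
  | succ t ih => rw [memoryAfter, List.getD_cons_succ, ih, memoryAfter]

theorem ValidFrom.valid_getD {ss : List (Superstep p V)} {M : Memory p V}
    (h : ValidFrom G M ss) (t : ℕ) :
    (ss.getD t Superstep.idle).Valid G (memoryAfter M ss t) := by
  induction ss generalizing M t with
  | nil => exact ⟨fun _ => trivial, fun _ hm => absurd hm List.not_mem_nil⟩
  | cons s ss ih =>
    cases t with
    | zero => exact h.1
    | succ t =>
      rw [List.getD_cons_succ, memoryAfter_cons_succ]
      exact ih h.2 t

namespace Execution

/-- Superstep `t` of the execution, which is idle if `t` is beyond the end. -/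
def superstep (A : Execution p V) (t : ℕ) : Superstep p V := A.steps.getD t Superstep.idle

/-- The memories at the beginning of superstep `t`. -/
def memory (A : Execution p V) (t : ℕ) : Memory p V := memoryAfter A.initialMemory A.steps t

/-- The value of `u` is sent at some time by a processor that satisfies `c` to one that does not. -/
def SendsAcross (A : Execution p V) (c : Fin p → Prop) (u : V) : Prop :=
  ∃ t P Q, c P ∧ ¬ c Q ∧ (A.superstep t).Sends u P Q

variable {A : Execution p V}

theorem superstep_mem_or_eq_idle (A : Execution p V) (t : ℕ) :
    A.superstep t ∈ A.steps ∨ A.superstep t = Superstep.idle := by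
  rcases lt_or_ge t A.steps.length with ht | ht
  · left
    rw [superstep, List.getD_eq_getElem _ _ ht]
    exact List.getElem_mem ht
  · exact Or.inr (List.getD_eq_default _ _ ht)

theorem superstep_mem_of_mem_ops {v : V} {t : ℕ} {P : Fin p} (hv : v ∈ (A.superstep t).ops P) :
    A.superstep t ∈ A.steps := by
  refine (A.superstep_mem_or_eq_idle t).resolve_right fun h => ?_
  rw [h] at hv
  exact List.not_mem_nil hv

theorem superstep_mem_of_mem_msgs {m : Message p V} {t : ℕ} (hm : m ∈ (A.superstep t).msgs) :
    A.superstep t ∈ A.steps := by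
  refine (A.superstep_mem_or_eq_idle t).resolve_right fun h => ?_
  rw [h] at hm
  exact List.not_mem_nil hm

theorem lt_length_of_mem_ops {v : V} {t : ℕ} {P : Fin p} (hv : v ∈ (A.superstep t).ops P) :
    t < A.steps.length := by
  by_contra! ht
  rw [superstep, List.getD_eq_default _ _ ht] at hv
  exact List.not_mem_nil hv

theorem sum_superstep (A : Execution p V) (f : Superstep p V → ℕ) :
    ∑ t ∈ range A.steps.length, f (A.superstep t) = (A.steps.map f).sum := by
  rw [← Fin.sum_univ_eq_sum_range fun t => f (A.superstep t), ← Fin.sum_univ_fun_getElem]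
  exact sum_congr rfl fun t _ => congrArg f (List.getD_eq_getElem _ _ t.2)

theorem existsUnique_mem_ops [DecidableEq V] {v : V} (hv : A.evalCount v = 1) :
    ∃! x : ℕ × Fin p, v ∈ (A.superstep x.1).ops x.2 := by
  rw [evalCount, ← A.sum_superstep fun s => ∑ P, (s.ops P).count v, ← sum_product'] at hv
  obtain ⟨x, ⟨-, hx⟩, huniq⟩ := existsUnique_ne_zero_of_sum_eq_one hv
  refine ⟨x, List.count_pos_iff.1 (Nat.pos_of_ne_zero hx), fun y hy => huniq y ⟨?_, ?_⟩⟩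
  · exact mem_product.2 ⟨mem_range.2 (lt_length_of_mem_ops hy), mem_univ _⟩
  · exact (List.count_pos_iff.2 hy).ne'

theorem card_le_commComplexity {S : Finset V} {r : Message p V → Prop} [DecidablePred r]
    (hr : ∀ s : Superstep p V, (s.msgs.countP fun m => r m) ≤ s.degree)
    (hS : ∀ u ∈ S, ∃ t, ∃ m ∈ (A.superstep t).msgs, r m ∧ m.payload = some (Word.val u)) :
    #S ≤ A.commComplexity := by
  calc #S ≤ (A.steps.flatMap Superstep.msgs).countP fun m => r m :=
        card_le_countP_of_forall_exists_payload fun u hu => by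
          obtain ⟨t, m, hm, h⟩ := hS u hu
          exact ⟨m, List.mem_flatMap.2 ⟨_, superstep_mem_of_mem_msgs hm, hm⟩, h⟩
    _ = (A.steps.map fun s => s.msgs.countP fun m => r m).sum := List.countP_flatMap
    _ ≤ A.commComplexity := List.sum_le_sum fun s _ => hr s

theorem card_le_commComplexity_of_sendsAcross_eq {S : Finset V} {P : Fin p}
    (hS : ∀ u ∈ S, A.SendsAcross (· = P) u) : #S ≤ A.commComplexity := by
  refine card_le_commComplexity (fun s => s.countP_src_le_degree P) fun u hu => ?_
  obtain ⟨t, Q, R, hQ, -, m, hm, hsrc, -, hpay⟩ := hS u hu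
  exact ⟨t, m, hm, hsrc.trans hQ, hpay⟩

theorem card_le_commComplexity_of_sendsAcross_ne {S : Finset V} {P : Fin p}
    (hS : ∀ u ∈ S, A.SendsAcross (· ≠ P) u) : #S ≤ A.commComplexity := by
  refine card_le_commComplexity (fun s => s.countP_dst_le_degree P) fun u hu => ?_
  obtain ⟨t, Q, R, -, hR, m, hm, -, hdst, hpay⟩ := hS u hu
  exact ⟨t, m, hm, hdst.trans (not_not.1 hR), hpay⟩

/-- A trajectory of the value of `u` from processor `P` at time `s` to processor `Q` at time `d`:
whenever `L` moves, the value is sent. Outside `[s, d]` the trajectory is constant. -/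
structure IsTrajectory (A : Execution p V) (u : V) (s : ℕ) (P : Fin p) (d : ℕ) (Q : Fin p)
    (L : ℕ → Fin p) : Prop where
  le : s ≤ d
  eq_start : ∀ t ≤ s, L t = P
  eq_end : ∀ t, d ≤ t → L t = Q
  sends : ∀ t, L t ≠ L (t + 1) → (A.superstep t).Sends u (L t) (L (t + 1))

namespace IsTrajectory

variable {u : V} {s d : ℕ} {P Q : Fin p} {L : ℕ → Fin p}

theorem const (A : Execution p V) (u : V) (s : ℕ) (P : Fin p) :
    A.IsTrajectory u s P s P fun _ => P :=
  ⟨le_rfl, fun _ _ => rfl, fun _ _ => rfl, fun _ h => absurd rfl h⟩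

theorem stay (hL : A.IsTrajectory u s P d Q L) : A.IsTrajectory u s P (d + 1) Q L :=
  ⟨hL.le.trans d.le_succ, hL.eq_start, fun t ht => hL.eq_end t (d.le_succ.trans ht), hL.sends⟩

theorem send (hL : A.IsTrajectory u s P d Q L) {R : Fin p} (hsend : (A.superstep d).Sends u Q R) :
    A.IsTrajectory u s P (d + 1) R fun t => if t ≤ d then L t else R where
  le := hL.le.trans d.le_succ
  eq_start t ht := by rw [if_pos (ht.trans hL.le), hL.eq_start t ht]
  eq_end t ht := if_neg (Nat.not_le.2 ht)
  sends t ht := by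
    rcases lt_trichotomy t d with htd | rfl | htd
    · simp only [htd.le, Nat.succ_le_of_lt htd, if_true] at ht ⊢
      exact hL.sends t ht
    · simpa [hL.eq_end t le_rfl] using hsend
    · simp [Nat.not_le.2 htd, Nat.not_le.2 (htd.trans t.lt_succ_self)] at ht

theorem sendsAcross (hL : A.IsTrajectory u s P d Q L) {c : Fin p → Prop} (hP : c P)
    (hQ : ¬ c Q) : A.SendsAcross c u := by
  obtain ⟨t, -, ht, ht'⟩ := exists_lt_and_not_succ (c := fun t => c (L t)) (d := d)
    (by rwa [hL.eq_start 0 s.zero_le]) (by rwa [hL.eq_end d le_rfl])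
  exact ⟨t, L t, L (t + 1), ht, ht', hL.sends t fun h => ht' (h ▸ ht)⟩

end IsTrajectory

theorem exists_isTrajectory_of_val_mem_memory (hA : ValidFrom G A.initialMemory A.steps) {u : V}
    {s : ℕ} {P : Fin p} (hu : ∀ t R, u ∈ (A.superstep t).ops R → t = s ∧ R = P) {d : ℕ}
    {Q : Fin p} (h : Word.val u ∈ A.memory d Q) : ∃ L, A.IsTrajectory u s P d Q L := by
  induction d generalizing Q with
  | zero =>
    obtain ⟨v, -, hv⟩ := h
    cases hv
  | succ d ih =>
    have hafterOps : ∀ R, Word.val u ∈ (A.superstep d).afterOps (A.memory d) R →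
        ∃ L, A.IsTrajectory u s P d R L := by
      rintro R (hR | ⟨v, hv, hvu⟩)
      · exact ih hR
      · cases hvu
        obtain ⟨rfl, rfl⟩ := hu d R hv
        exact ⟨_, IsTrajectory.const A u d R⟩
    rcases h with h | ⟨m, hm, hdst, hpay⟩
    · obtain ⟨L, hL⟩ := hafterOps Q h
      exact ⟨L, hL.stay⟩
    · obtain ⟨L, hL⟩ := hafterOps m.src ((hA.valid_getD d).2 m hm _ hpay)
      exact ⟨_, hL.send ⟨m, hm, rfl, hdst, hpay⟩⟩

/-- The time and the processor of the only evaluation of each node of `G`, and for each arc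
`u → v` a trajectory `loc u v` of the value of `u` to the evaluation of `v`. -/
structure Schedule (A : Execution p V) (G : ComputationDAG V) where
  time : V → ℕ
  proc : V → Fin p
  loc : V → V → ℕ → Fin p
  mem_ops_iff : ∀ v t P, v ∈ (A.superstep t).ops P ↔ t = time v ∧ P = proc v
  isTrajectory : ∀ u v, G.arc u v →
    A.IsTrajectory u (time u) (proc u) (time v) (proc v) (loc u v)

theorem EvaluatesWithoutRecomputation.nonempty_schedule [DecidableEq V]
    (hA : A.EvaluatesWithoutRecomputation G) : Nonempty (A.Schedule G) := by
  choose x hx huniq using fun v => existsUnique_mem_ops (hA.2 v)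
  have hops : ∀ v t P, v ∈ (A.superstep t).ops P ↔ t = (x v).1 ∧ P = (x v).2 := fun v t P => by
    refine ⟨fun h => Prod.ext_iff.1 (huniq v (t, P) h), ?_⟩
    rintro ⟨rfl, rfl⟩
    exact hx v
  have htraj : ∀ u v, ∃ L, G.arc u v →
      A.IsTrajectory u (x u).1 (x u).2 (x v).1 (x v).2 L := fun u v => by
    by_cases huv : G.arc u v
    · rcases ((hA.1.1.valid_getD (x v).1).1 (x v).2).val_mem_or_mem huv (hx v) with hu | hu
      · obtain ⟨L, hL⟩ := exists_isTrajectory_of_val_mem_memory hA.1.1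
          (fun t P => (hops u t P).1) hu
        exact ⟨L, fun _ => hL⟩
      · obtain ⟨htime, hproc⟩ := (hops u _ _).1 hu
        refine ⟨fun _ => (x u).2, fun _ => ?_⟩
        rw [htime, hproc]
        exact IsTrajectory.const A u _ _
    · exact ⟨fun _ => (x u).2, fun h => absurd h huv⟩
  choose loc hloc using htraj
  exact ⟨⟨fun v => (x v).1, fun v => (x v).2, loc, hops, hloc⟩⟩

namespace Schedule

variable (S : A.Schedule G)

theorem mem_ops (v : V) : v ∈ (A.superstep (S.time v)).ops (S.proc v) :=
  (S.mem_ops_iff v _ _).2 ⟨rfl, rfl⟩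

theorem time_lt_length (v : V) : S.time v < A.steps.length := lt_length_of_mem_ops (S.mem_ops v)

theorem outputsOf_eq (P : Fin p) : A.outputsOf G P = {v | G.IsOutput v ∧ S.proc v = P} := by
  ext v
  refine and_congr_right fun _ => ⟨?_, ?_⟩
  · rintro ⟨s, hs, hv⟩
    obtain ⟨t, ht, rfl⟩ := List.getElem_of_mem hs
    rw [← List.getD_eq_getElem _ Superstep.idle ht] at hv
    exact ((S.mem_ops_iff v t P).1 hv).2.symm
  · rintro rfl
    exact ⟨_, superstep_mem_of_mem_ops (S.mem_ops v), S.mem_ops v⟩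

theorem exists_sendsAcross_of_path {c : Fin p → Prop} {k : ℕ} {v : ℕ → V}
    (hv : ∀ l < k, G.arc (v l) (v (l + 1))) (h0 : c (S.proc (v 0))) (hk : ¬ c (S.proc (v k))) :
    ∃ l < k, A.SendsAcross c (v l) := by
  obtain ⟨l, hlk, hl, hl'⟩ := exists_lt_and_not_succ (c := fun l => c (S.proc (v l))) h0 hk
  exact ⟨l, hlk, (S.isTrajectory _ _ (hv l hlk)).sendsAcross hl hl'⟩

theorem card_le_of_disjoint_paths {ι : Type*} {W : Finset ι} {c : Fin p → Prop} {k H : ℕ}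
    {v : ι → ℕ → V} (hv : ∀ i ∈ W, ∀ l < k, G.arc (v i l) (v i (l + 1)))
    (hdisj : ∀ i ∈ W, ∀ j ∈ W, ∀ l < k, ∀ l' < k, v i l = v j l' → i = j)
    (h0 : ∀ i ∈ W, c (S.proc (v i 0))) (hk : ∀ i ∈ W, ¬ c (S.proc (v i k)))
    (hH : ∀ U : Finset V, (∀ u ∈ U, A.SendsAcross c u) → #U ≤ H) : #W ≤ H := by
  classical
  choose! l hl hsend using fun i hi => S.exists_sendsAcross_of_path (hv i hi) (h0 i hi) (hk i hi)
  rw [← card_image_of_injOn (f := fun i => v i (l i))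
    fun i hi j hj => hdisj i hi j hj _ (hl i hi) _ (hl j hj)]
  exact hH _ (forall_mem_image.2 hsend)

end Schedule

end Execution

end BSP

section Allocations

theorem natCast_pow_le_exp_mul_log {m c : ℕ} (hmc : m ≤ c) (N : ℕ) :
    (N : ℝ) ^ m ≤ Real.exp (c * Real.log N) := by
  rcases Nat.eq_zero_or_pos N with rfl | hN
  · simpa using pow_le_one₀ (n := m) le_rfl zero_le_one
  · rw [mul_comm, ← Real.rpow_def_of_pos (Nat.cast_pos.2 hN), Real.rpow_natCast]
    exact pow_le_pow_right₀ (Nat.one_le_cast.2 hN) hmc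

theorem log_natCast_le {r : ℝ} (hr : Real.exp 1 ≤ r) (N : ℕ) :
    Real.log N ≤ Real.log r + (N / r - 1) := by
  have hr0 : 0 < r := (Real.exp_pos 1).trans_le hr
  rcases Nat.eq_zero_or_pos N with rfl | hN
  · have hlog : 1 ≤ Real.log r := (Real.le_log_iff_exp_le hr0).2 hr
    simp only [Nat.cast_zero, Real.log_zero, zero_div]
    linarith
  · have hlog := Real.log_le_sub_one_of_pos (div_pos (Nat.cast_pos.2 hN) hr0)
    rw [Real.log_div (by positivity) hr0.ne'] at hlog
    linarith

theorem sum_log_natCast_le {ι : Type*} [Fintype ι] (N : ι → ℕ)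
    (hN : (Fintype.card ι : ℝ) ≤ (∑ i, N i : ℕ) / Real.exp 1) :
    ∑ i, Real.log (N i) ≤ Fintype.card ι * Real.log ((∑ i, N i : ℕ) / Fintype.card ι) := by
  rcases isEmpty_or_nonempty ι with _ | _
  · simp
  set s : ℕ := ∑ i, N i with hs
  have hι : (0 : ℝ) < Fintype.card ι := Nat.cast_pos.2 Fintype.card_pos
  have hr : Real.exp 1 ≤ s / Fintype.card ι := (le_div_comm₀ hι (Real.exp_pos 1)).1 hN
  have hs0 : (s : ℝ) ≠ 0 := fun h => by
    rw [h, zero_div] at hr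
    exact (Real.exp_pos 1).not_ge hr
  calc ∑ i, Real.log (N i)
      ≤ ∑ i, (Real.log (s / Fintype.card ι) + (N i / (s / Fintype.card ι) - 1)) :=
        sum_le_sum fun i _ => log_natCast_le hr (N i)
    _ = Fintype.card ι * Real.log (s / Fintype.card ι) := by
        rw [sum_add_distrib, sum_sub_distrib, ← sum_div, ← Nat.cast_sum, ← hs,
          div_div_cancel₀ hs0]
        simp

theorem prod_card_fiber_le {X K Q : Type*} [Fintype X] [Fintype K] [Fintype Q] [DecidableEq Q]
    (β : X → Q) {src : K → Q} {c : ℕ} (hc : ∀ P, #{a | src a = P} ≤ c)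
    (hQ : (Fintype.card Q : ℝ) ≤ Fintype.card X / Real.exp 1) :
    ∏ a, (#{x | β x = src a} : ℝ) ≤
      Real.exp (c * (Fintype.card Q * Real.log (Fintype.card X / Fintype.card Q))) := by
  have hsum : ∑ P, #{x | β x = P} = Fintype.card X :=
    (card_eq_sum_card_fiberwise fun _ _ => mem_univ _).symm
  calc ∏ a, (#{x | β x = src a} : ℝ)
      = ∏ P, (#{x | β x = P} : ℝ) ^ #{a | src a = P} := by
        rw [← prod_fiberwise univ src]
        refine prod_congr rfl fun P _ => ?_
        rw [← prod_const]
        exact prod_congr rfl fun a ha => by rw [(mem_filter.1 ha).2]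
    _ ≤ ∏ P, Real.exp (c * Real.log (#{x | β x = P} : ℕ)) :=
        prod_le_prod (fun _ _ => by positivity) fun P _ => natCast_pow_le_exp_mul_log (hc P) _
    _ = Real.exp (c * ∑ P, Real.log (#{x | β x = P} : ℕ)) := by
        rw [← Real.exp_sum, mul_sum]
    _ ≤ Real.exp (c * (Fintype.card Q * Real.log (Fintype.card X / Fintype.card Q))) := by
        have hlog := sum_log_natCast_le (fun P : Q => #{x | β x = P}) (by rwa [hsum])
        rw [hsum] at hlog
        gcongr

theorem natCard_sigma_pi_subtype_le {ι K X : Type*} [Finite ι] [Fintype K] [Fintype X]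
    (r : ι → K → X → Prop) [∀ i a, DecidablePred (r i a)] {B : ℝ}
    (hB : ∀ i, ∏ a, (#{x | r i a x} : ℝ) ≤ B) :
    (Nat.card (Σ i, ∀ a, {x // r i a x}) : ℝ) ≤ Nat.card ι * B := by
  have := Fintype.ofFinite ι
  calc (Nat.card (Σ i, ∀ a, {x // r i a x}) : ℝ) = ∑ i, ∏ a, (#{x | r i a x} : ℝ) := by
        simp [Nat.card_sigma, Nat.card_pi, Fintype.card_subtype]
    _ ≤ ∑ _i : ι, B := sum_le_sum fun i _ => hB i
    _ = Nat.card ι * B := by simp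

theorem natCard_range_le_of_moves {S X K Q : Type*} [Fintype X] [Fintype K] [Finite Q]
    [DecidableEq Q] {α α' : S → X → Q} {src dst : K → Q} {g : S → K → X}
    (hsrc : ∀ σ a, α σ (g σ a) = src a) (hα' : ∀ σ, α' σ = Function.extend (g σ) dst (α σ))
    {B : ℝ} (hB : ∀ β : X → Q, ∏ a, (#{x | β x = src a} : ℝ) ≤ B) :
    (Nat.card (Set.range α') : ℝ) ≤ Nat.card (Set.range α) * B := by
  let F : (Σ β : Set.range α, ∀ a, {x // β.1 x = src a}) → X → Q := fun y =>
    Function.extend (fun a => (y.2 a).1) dst y.1.1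
  have hF : Set.range α' ⊆ Set.range F := by
    rintro _ ⟨σ, rfl⟩
    exact ⟨⟨⟨α σ, σ, rfl⟩, fun a => ⟨g σ a, hsrc σ a⟩⟩, (hα' σ).symm⟩
  have hcard : Nat.card (Set.range α') ≤ Nat.card (Σ β : Set.range α, ∀ a, {x // β.1 x = src a}) :=
    (Nat.card_mono (Set.toFinite _) hF).trans (Finite.card_range_le F)
  exact (Nat.cast_le.2 hcard).trans
    (natCard_sigma_pi_subtype_le (fun (β : Set.range α) a x => β.1 x = src a) fun β => hB β.1)

end Allocations

/-- Packets routed through levels `0, …, m` of arcs: under the setting `σ`, the packet `a` takes the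
arc `route σ l a` of level `l`, at each level one packet per arc. A packet can be on the arc `x` of
level `l` from time `departure l x` to time `arrival l x`, and `loc t l x` is the processor that
holds it if it is there at time `t`. Departures, arrivals and locations do not depend on the
setting. Packets are named by the arcs of level `0`. -/
structure PacketRouting (S X Q : Type*) (m : ℕ) where
  route : S → ℕ → Equiv.Perm X
  departure : ℕ → X → ℕ
  arrival : ℕ → X → ℕ
  loc : ℕ → ℕ → X → Q
  route_zero : ∀ σ, route σ 0 = 1
  departure_le_arrival : ∀ l < m, ∀ x, departure l x ≤ arrival l x
  arrival_route : ∀ σ, ∀ l < m, ∀ a,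
    arrival l (route σ l a) = departure (l + 1) (route σ (l + 1) a)
  loc_arrival : ∀ σ, ∀ l < m, ∀ a, loc (arrival l (route σ l a)) l (route σ l a) =
    loc (arrival l (route σ l a)) (l + 1) (route σ (l + 1) a)

namespace PacketRouting

variable {S X Q : Type*} {m : ℕ} (R : PacketRouting S X Q m) {σ : S} {a : X}

/-- The level of the arc on which the packet `a` is at time `t` under the setting `σ`. -/
def level (σ : S) (a : X) (t : ℕ) : ℕ :=
  Nat.findGreatest (fun l => R.departure l (R.route σ l a) < t) m

/-- The processor that holds the packet `a` at time `t` under the setting `σ`. -/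
def alloc (σ : S) (t : ℕ) (a : X) : Q := R.loc t (R.level σ a t) (R.route σ (R.level σ a t) a)

/-- The arc `x` of level `l` holds a packet at time `t`, under one and then under every setting:
this is a condition on the arc alone. -/
def IsCurrent (t l : ℕ) (x : X) : Prop :=
  l ≤ m ∧ (l ≠ 0 → R.departure l x < t) ∧ (l < m → t ≤ R.arrival l x)

theorem level_le (σ : S) (a : X) (t : ℕ) : R.level σ a t ≤ m := Nat.findGreatest_le m

theorem departure_route_mono {l l' : ℕ} (h : l ≤ l') (hl' : l' ≤ m) :
    R.departure l (R.route σ l a) ≤ R.departure l' (R.route σ l' a) := by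
  induction l', h using Nat.le_induction with
  | base => exact le_rfl
  | succ l' _ ih =>
    rw [← R.arrival_route σ l' hl']
    exact (ih (Nat.le_of_succ_le hl')).trans (R.departure_le_arrival l' hl' _)

theorem isCurrent_route_iff {t l : ℕ} :
    R.IsCurrent t l (R.route σ l a) ↔ R.level σ a t = l := by
  rw [level, Nat.findGreatest_eq_iff, IsCurrent]
  refine and_congr_right fun _ => and_congr_right fun _ =>
    ⟨fun h l' hll' hl'm => ?_, fun h hlt => ?_⟩
  · have hlm : l < m := hll'.trans_le hl'm
    rw [not_lt]
    exact (R.arrival_route σ l hlm a ▸ h hlm).trans (R.departure_route_mono hll' hl'm)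
  · rw [R.arrival_route σ l hlt]
    exact not_lt.1 (h l.lt_succ_self hlt)

theorem level_mono (σ : S) (a : X) : Monotone (R.level σ a) := fun _ _ h =>
  Nat.findGreatest_mono_left (fun _ => h.trans_lt') m

-- A packet that changes level in the step from `t` to `t + 1` passes arcs that arrive at time `t`.
theorem alloc_eq_loc_level_succ (σ : S) (t : ℕ) (a : X) :
    R.alloc σ t a = R.loc t (R.level σ a (t + 1)) (R.route σ (R.level σ a (t + 1)) a) := by
  have hle : R.level σ a t ≤ R.level σ a (t + 1) := R.level_mono σ a t.le_succ
  have hm := R.level_le σ a (t + 1)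
  have hleave := (R.isCurrent_route_iff.2 (rfl : R.level σ a t = _)).2.2
  have henter := (R.isCurrent_route_iff.2 (rfl : R.level σ a (t + 1) = _)).2.1
  suffices h : ∀ l, R.level σ a t ≤ l → l ≤ R.level σ a (t + 1) →
      R.loc t (R.level σ a t) (R.route σ (R.level σ a t) a) = R.loc t l (R.route σ l a) from
    h _ hle le_rfl
  refine Nat.le_induction (fun _ => rfl) fun l hl ih hl' => ?_
  have hlm : l < m := hl'.trans hm
  have harr : R.arrival l (R.route σ l a) = t := by
    rw [R.arrival_route σ l hlm]
    refine le_antisymm ((R.departure_route_mono hl' hm).trans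
      (Nat.le_of_lt_succ (henter (Nat.ne_of_gt (Nat.zero_lt_of_lt hl'))))) ?_
    have := hleave (hl.trans_lt hlm)
    rw [R.arrival_route σ _ (hl.trans_lt hlm)] at this
    exact this.trans (R.departure_route_mono (Nat.succ_le_succ hl) hlm)
  rw [ih (Nat.le_of_succ_le hl')]
  simpa only [harr] using R.loc_arrival σ l hlm a

theorem alloc_zero (σ : S) : R.alloc σ 0 = R.loc 0 0 := by
  have hlevel : ∀ a, R.level σ a 0 = 0 := fun a =>
    Nat.findGreatest_eq_zero_iff.2 fun _ _ _ => Nat.not_lt_zero _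
  funext a
  rw [alloc, hlevel, R.route_zero, Equiv.Perm.one_apply]

theorem alloc_of_forall_departure_lt {T : ℕ} (hT : ∀ x, R.departure m x < T) (σ : S) (a : X) :
    R.alloc σ T a = R.loc T m (R.route σ m a) := by
  have hlevel : R.level σ a T = m := Nat.findGreatest_eq (hT _)
  rw [alloc, hlevel]

-- The arcs that hold a moving packet at time `t + 1` do not depend on the setting `σ`, so the new
-- allocation is determined by the old one and by which packets are on those arcs.
theorem natCard_range_alloc_succ_le [Fintype X] [Fintype Q] [DecidableEq Q] {c t : ℕ}
    (hc : ∀ P, #{x : Fin (m + 1) × X | R.loc t x.1 x.2 = P ∧ R.loc (t + 1) x.1 x.2 ≠ P} ≤ c)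
    (hQ : (Fintype.card Q : ℝ) ≤ Fintype.card X / Real.exp 1) :
    (Nat.card (Set.range fun σ => R.alloc σ (t + 1)) : ℝ) ≤
      Nat.card (Set.range fun σ => R.alloc σ t) *
        Real.exp (c * (Fintype.card Q * Real.log (Fintype.card X / Fintype.card Q))) := by
  classical
  let K := {x : Fin (m + 1) × X //
    R.IsCurrent (t + 1) x.1 x.2 ∧ R.loc (t + 1) x.1 x.2 ≠ R.loc t x.1 x.2}
  let g : S → K → X := fun σ x => (R.route σ x.1.1).symm x.1.2
  have hroute : ∀ σ x, R.route σ x.1.1 (g σ x) = x.1.2 := fun σ x => Equiv.apply_symm_apply _ _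
  have hlevel : ∀ σ x, R.level σ (g σ x) (t + 1) = x.1.1 := fun σ x => by
    rw [← isCurrent_route_iff, hroute]
    exact x.2.1
  have hnew : ∀ σ x, R.alloc σ (t + 1) (g σ x) = R.loc (t + 1) x.1.1 x.1.2 := fun σ x => by
    rw [alloc, hlevel, hroute]
  refine natCard_range_le_of_moves (g := g) (src := fun x => R.loc t x.1.1 x.1.2)
    (dst := fun x => R.loc (t + 1) x.1.1 x.1.2) (fun σ x => ?_) (fun σ => funext fun a => ?_)
    fun β => prod_card_fiber_le β (fun P => ?_) hQ
  · rw [alloc_eq_loc_level_succ, hlevel, hroute]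
  · by_cases ha : ∃ x, g σ x = a
    · obtain ⟨x, rfl⟩ := ha
      rw [hnew, Function.FactorsThrough.extend_apply (fun y z h => ?_)]
      rw [← hnew, ← hnew, h]
    · rw [Function.extend_apply' _ _ _ ha, R.alloc_eq_loc_level_succ σ t, alloc]
      by_contra hne
      exact ha ⟨⟨(⟨_, Nat.lt_succ_of_le (R.level_le σ a (t + 1))⟩, R.route σ _ a),
        R.isCurrent_route_iff.2 rfl, hne⟩, Equiv.symm_apply_apply _ _⟩
  · refine (card_le_card_of_injOn Subtype.val (fun x hx => ?_)
      Subtype.val_injective.injOn).trans (hc P)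
    obtain rfl := (mem_filter.1 hx).2
    exact mem_filter.2 ⟨mem_univ _, rfl, x.2.2⟩

variable [Fintype X] [Fintype Q] [DecidableEq Q]

theorem natCard_range_alloc_le {c : ℕ → ℕ}
    (hc : ∀ t P, #{x : Fin (m + 1) × X | R.loc t x.1 x.2 = P ∧ R.loc (t + 1) x.1 x.2 ≠ P} ≤ c t)
    (hQ : (Fintype.card Q : ℝ) ≤ Fintype.card X / Real.exp 1) (T : ℕ) :
    (Nat.card (Set.range fun σ => R.alloc σ T) : ℝ) ≤ Real.exp ((∑ t ∈ range T, c t : ℕ) *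
      (Fintype.card Q * Real.log (Fintype.card X / Fintype.card Q))) := by
  induction T with
  | zero =>
    have hone : Nat.card (Set.range fun σ => R.alloc σ 0) ≤ 1 := by
      simp only [alloc_zero]
      exact (Nat.card_mono (Set.finite_singleton _) Set.range_const_subset).trans_eq (by simp)
    simpa using hone
  | succ T ih =>
    refine (R.natCard_range_alloc_succ_le (hc T) hQ).trans ?_
    rw [sum_range_succ, Nat.cast_add, add_mul, Real.exp_add]
    gcongr

theorem natCard_settings_le (hR : Function.Injective fun σ => R.route σ m) {c : ℕ → ℕ}
    (hc : ∀ t P, #{x : Fin (m + 1) × X | R.loc t x.1 x.2 = P ∧ R.loc (t + 1) x.1 x.2 ≠ P} ≤ c t)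
    (hQ : (Fintype.card Q : ℝ) ≤ Fintype.card X / Real.exp 1) {T r : ℕ}
    (hT : ∀ x, R.departure m x < T) (hr : ∀ P, #{x | R.loc T m x = P} ≤ r) :
    (Nat.card S : ℝ) ≤ Real.exp ((∑ t ∈ range T, c t : ℕ) *
      (Fintype.card Q * Real.log (Fintype.card X / Fintype.card Q))) *
        (r : ℝ) ^ Fintype.card X := by
  let F : S → Σ β : Set.range fun σ => R.alloc σ T, ∀ a, {x // R.loc T m x = β.1 a} := fun σ =>
    ⟨⟨R.alloc σ T, σ, rfl⟩, fun a => ⟨R.route σ m a, (R.alloc_of_forall_departure_lt hT σ a).symm⟩⟩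
  have hF : Function.Injective F := fun σ σ' h => hR <| Equiv.ext fun a =>
    congrArg (fun y => ((y.2 a).1 : X)) h
  have hfiber : ∀ β : X → Q, ∏ a, (#{x | R.loc T m x = β a} : ℝ) ≤ (r : ℝ) ^ Fintype.card X :=
    fun β => (prod_le_prod (fun _ _ => by positivity) fun a _ => Nat.cast_le.2 (hr (β a))).trans_eq
      (by rw [prod_const, card_univ])
  have hcard := Nat.card_le_card_of_injective F hF
  refine (Nat.cast_le.2 hcard).trans <| (natCard_sigma_pi_subtype_le
    (fun (β : Set.range fun σ => R.alloc σ T) a x => R.loc T m x = β.1 a)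
      fun β => hfiber β.1).trans ?_
  gcongr
  exact R.natCard_range_alloc_le hc hQ T

end PacketRouting

theorem card_bitVec (k : ℕ) : Fintype.card (BitVec k) = 2 ^ k :=
  (Fintype.card_congr BitVec.equivFin.toEquiv).trans (Fintype.card_fin _)

namespace FFT

open BSP BSP.Execution

variable {k l m p : ℕ}

section Network

/-- The row of the head of the straight (`b = false`) or crossing (`b = true`) arc `(w, b)` that
leaves row `w` of level `l`. -/
def headRow (l : ℕ) (x : BitVec k × Bool) : BitVec k :=
  if x.2 then x.1 ^^^ BitVec.twoPow k l else x.1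

theorem headRow_headRow (l : ℕ) (w : BitVec k) (b : Bool) :
    headRow l (headRow l (w, b), b) = w := by
  cases b <;> simp [headRow]

theorem headRow_left_injective (l : ℕ) (b : Bool) :
    Function.Injective fun w : BitVec k => headRow l (w, b) :=
  Function.LeftInverse.injective (g := fun w => headRow l (w, b)) fun w => headRow_headRow l w b

theorem getLsbD_headRow (hl : l < k) (x : BitVec k × Bool) (i : ℕ) :
    (headRow l x).getLsbD i = (x.1.getLsbD i ^^ (x.2 && decide (i = l))) := by
  rcases x with ⟨w, _ | _⟩
  · simp [headRow]
  · simp only [headRow, if_true, BitVec.getLsbD_xor, BitVec.getLsbD_twoPow, hl, decide_true,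
      Bool.true_and, eq_comm]

theorem eq_of_headRow_eq (hl : l < k) {x y : BitVec k × Bool} (h : headRow l x = headRow l y)
    (hbit : x.1.getLsbD l = y.1.getLsbD l) : x = y := by
  have hb : x.2 = y.2 := by
    simpa [getLsbD_headRow hl, hbit] using congrArg (BitVec.getLsbD · l) h
  exact Prod.ext (headRow_left_injective l x.2 (h.trans (by rw [hb]))) hb

/-- The packets that enter the rows of level `l + 1` along the arcs of level `l` leave them along
the straight and crossing arcs, both exchanged in the rows `w` with `s w`. -/
def switch (s : BitVec k → Bool) (l : ℕ) : Equiv.Perm (BitVec k × Bool) where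
  toFun x := (headRow l x, x.2 ^^ s (headRow l x))
  invFun y := (headRow l (y.1, y.2 ^^ s y.1), y.2 ^^ s y.1)
  left_inv := fun ⟨w, b⟩ => by simp [headRow_headRow]
  right_inv := fun ⟨w, b⟩ => by simp [headRow_headRow]

theorem switch_left_injective (l : ℕ) :
    Function.Injective fun s : BitVec k → Bool => switch s l := fun s s' h => funext fun w => by
  have := congrArg Prod.snd (DFunLike.congr_fun h (w, false))
  simpa [switch, headRow] using this

/-- The arc of each level taken by the packet that starts on a given arc of level `0`, when the
switches of level `l + 1` are set to `σ l`. -/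
def route (σ : ℕ → BitVec k → Bool) : ℕ → Equiv.Perm (BitVec k × Bool)
  | 0 => 1
  | l + 1 => (route σ l).trans (switch (σ l) l)

theorem getLsbD_route_of_le (σ : ℕ → BitVec k → Bool) {l i : ℕ} (hl : l ≤ i) (hi : i < k)
    (a : BitVec k × Bool) : (route σ l a).1.getLsbD i = a.1.getLsbD i := by
  induction l with
  | zero => rfl
  | succ l ih =>
    have hli : l < i := hl
    rw [← ih hli.le]
    exact (getLsbD_headRow (hli.trans hi) _ i).trans (by simp [hli.ne'])

-- Until level `l`, a packet has kept the bit `l` of its row: hence its last arc determines the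
-- previous ones.
theorem route_eq_of_le (hm : m ≤ k) {σ σ' : ℕ → BitVec k → Bool} (h : route σ m = route σ' m)
    (hl : l ≤ m) : route σ l = route σ' l := by
  induction hl using Nat.decreasingInduction with
  | self => exact h
  | of_succ l hl ih =>
    have hlk : l < k := lt_of_lt_of_le hl hm
    refine Equiv.ext fun a => eq_of_headRow_eq hlk ?_ ?_
    · exact congrArg Prod.fst (DFunLike.congr_fun ih a)
    · rw [getLsbD_route_of_le σ le_rfl hlk, getLsbD_route_of_le σ' le_rfl hlk]

theorem eq_of_route_eq (hm : m ≤ k) {σ σ' : ℕ → BitVec k → Bool} (h : route σ m = route σ' m)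
    (hl : l < m) : σ l = σ' l := by
  have hsucc : (route σ l).trans (switch (σ l) l) = (route σ' l).trans (switch (σ' l) l) :=
    route_eq_of_le hm h hl
  rw [route_eq_of_le hm h hl.le] at hsucc
  exact switch_left_injective l (mul_right_cancel (b := route σ' l) hsucc)

/-- Settings of the switches of levels `1, …, m`, extended by straight switches to all levels. -/
def extendSetting (σ : Fin m → BitVec k → Bool) (l : ℕ) (w : BitVec k) : Bool :=
  if h : l < m then σ ⟨l, h⟩ w else false

theorem route_extendSetting_injective (hm : m ≤ k) :
    Function.Injective fun σ : Fin m → BitVec k → Bool => route (extendSetting σ) m :=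
  fun σ σ' h => funext fun l => by
    have := eq_of_route_eq hm h l.2
    exact funext fun w => by simpa [extendSetting] using congrFun this w

end Network

section Nodes

/-- The node in row `w` of level `l ≤ k`. -/
def node (w : BitVec k) (l : ℕ) : FFTNode k := (w.toFin, ⟨min l k, by omega⟩)

theorem node_inj {w w' : BitVec k} {l l' : ℕ} (hl : l ≤ k) (hl' : l' ≤ k) :
    node w l = node w' l' ↔ w = w' ∧ l = l' := by
  simp [node, hl, hl', BitVec.toFin_inj]

theorem node_left_injective (l : ℕ) : Function.Injective fun w : BitVec k => node w l :=
  fun _ _ h => BitVec.eq_of_toFin_eq (congrArg Prod.fst h)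

theorem fftDAG_arc_node (hl : l < k) (x : BitVec k × Bool) :
    (fftDAG k).arc (node x.1 l) (node (headRow l x) (l + 1)) := by
  refine ⟨by simp [node, hl.le, Nat.succ_le_of_lt hl], ?_⟩
  rcases x with ⟨w, _ | _⟩
  · exact Or.inl rfl
  · refine Or.inr fun i => ?_
    have hbit := getLsbD_headRow hl (w, true) i
    simp only [BitVec.getLsbD] at hbit
    cases hw : w.toNat.testBit i <;> simp [node, hl.le, hbit, hw]

theorem node_ofFin (v : FFTNode k) : node (BitVec.ofFin v.1) v.2 = v :=
  Prod.ext rfl (Fin.ext (min_eq_left (Nat.le_of_lt_succ v.2.2)))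

theorem isOutput_fftDAG_iff {v : FFTNode k} : (fftDAG k).IsOutput v ↔ ∃ w, node w k = v := by
  refine ⟨fun hv => ⟨BitVec.ofFin v.1, ?_⟩, ?_⟩
  · have hlevel : k ≤ v.2 := not_lt.1 fun h =>
      hv _ (node_ofFin v ▸ fftDAG_arc_node h (BitVec.ofFin v.1, false))
    have hk : k = v.2 := le_antisymm hlevel (Nat.le_of_lt_succ v.2.2)
    exact (congrArg (node (BitVec.ofFin v.1)) hk).trans (node_ofFin v)
  · rintro ⟨w, rfl⟩ u ⟨hu, -⟩
    have := u.2.2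
    simp only [node, min_self] at hu
    omega

end Nodes

section Counting

variable {A : Execution p (FFTNode k)}

theorem ncard_outputsOf (S : A.Schedule (fftDAG k)) (P : Fin p) :
    (A.outputsOf (fftDAG k) P).ncard = #{w : BitVec k | S.proc (node w k) = P} := by
  have himage : A.outputsOf (fftDAG k) P =
      ((univ.filter fun w : BitVec k => S.proc (node w k) = P).image (node · k) : Finset _) := by
    ext v
    simp only [S.outputsOf_eq, isOutput_fftDAG_iff, coe_image, coe_filter_univ]
    constructor
    · rintro ⟨⟨w, rfl⟩, hw⟩
      exact ⟨w, hw, rfl⟩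
    · rintro ⟨w, hw, rfl⟩
      exact ⟨⟨w, rfl⟩, hw⟩
  rw [himage, Set.ncard_coe_finset, card_image_of_injective _ (node_left_injective k)]

theorem card_le_maxOutputs (S : A.Schedule (fftDAG k)) (P : Fin p) :
    #{w : BitVec k | S.proc (node w k) = P} ≤ A.maxOutputs (fftDAG k) := by
  rw [← ncard_outputsOf]
  exact le_sup (f := fun P => (A.outputsOf (fftDAG k) P).ncard) (mem_univ P)

theorem exists_card_eq_maxOutputs (S : A.Schedule (fftDAG k)) :
    ∃ P, #{w : BitVec k | S.proc (node w k) = P} = A.maxOutputs (fftDAG k) := by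
  have : Nonempty (Fin p) := ⟨S.proc (node 0 0)⟩
  obtain ⟨P, -, hP⟩ := exists_mem_eq_sup univ univ_nonempty
    fun P => (A.outputsOf (fftDAG k) P).ncard
  exact ⟨P, (ncard_outputsOf S P).symm.trans hP.symm⟩

theorem two_pow_le_mul_maxOutputs (S : A.Schedule (fftDAG k)) :
    2 ^ k ≤ p * A.maxOutputs (fftDAG k) := by
  calc 2 ^ k = ∑ P, #{w : BitVec k | S.proc (node w k) = P} := by
        rw [← card_bitVec, ← card_univ]
        exact card_eq_sum_card_fiberwise fun _ _ => mem_univ _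
    _ ≤ ∑ _P : Fin p, A.maxOutputs (fftDAG k) := sum_le_sum fun P _ => card_le_maxOutputs S P
    _ = p * A.maxOutputs (fftDAG k) := by simp

end Counting

section Packets

variable {A : Execution p (FFTNode (m + 1))}

/-- The routings of the `2 ^ (m + 2)` packets that start on the arcs of level `0` by all settings
of the switches of levels `1, …, m`, where the packet on an arc stands for the value that is
carried along this arc. -/
def packetRouting (S : A.Schedule (fftDAG (m + 1))) :
    PacketRouting (Fin m → BitVec (m + 1) → Bool) (BitVec (m + 1) × Bool) (Fin p) m where
  route σ := route (extendSetting σ)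
  departure l x := S.time (node x.1 l)
  arrival l x := S.time (node (headRow l x) (l + 1))
  loc t l x := S.loc (node x.1 l) (node (headRow l x) (l + 1)) t
  route_zero _ := rfl
  departure_le_arrival _ hl x :=
    (S.isTrajectory _ _ (fftDAG_arc_node (Nat.lt_succ_of_lt hl) x)).le
  arrival_route _ _ _ _ := rfl
  loc_arrival σ l hl a :=
    ((S.isTrajectory _ _ (fftDAG_arc_node (Nat.lt_succ_of_lt hl) _)).eq_end _ le_rfl).trans
      ((S.isTrajectory _ _ (fftDAG_arc_node (Nat.succ_lt_succ hl)
        (route (extendSetting σ) (l + 1) a))).eq_start _ le_rfl).symm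

theorem card_moves_le (S : A.Schedule (fftDAG (m + 1))) (t : ℕ) (P : Fin p) :
    #{x : Fin (m + 1) × BitVec (m + 1) × Bool | (packetRouting S).loc t x.1 x.2 = P ∧
      (packetRouting S).loc (t + 1) x.1 x.2 ≠ P} ≤ 2 * (A.superstep t).degree := by
  classical
  let U : Finset (FFTNode (m + 1)) := {u | ∃ Q, (A.superstep t).Sends u P Q}
  have hU : #U ≤ (A.superstep t).degree :=
    Superstep.card_le_degree_of_sends fun u hu => (mem_filter.1 hu).2
  suffices h : _ ≤ #(U ×ˢ (univ : Finset Bool)) by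
    rw [card_product, card_univ, Fintype.card_bool, mul_comm] at h
    exact h.trans (Nat.mul_le_mul_left 2 hU)
  refine card_le_card_of_injOn (fun x => (node x.2.1 x.1, x.2.2)) (fun x hx => ?_) ?_
  · obtain ⟨-, hx, hx'⟩ := mem_filter.1 hx
    have hsend : (A.superstep t).Sends (node x.2.1 x.1) ((packetRouting S).loc t x.1 x.2)
        ((packetRouting S).loc (t + 1) x.1 x.2) :=
      (S.isTrajectory _ _ (fftDAG_arc_node x.1.2 x.2)).sends t fun h => hx' (h.symm.trans hx)
    rw [hx] at hsend
    exact mem_coe.2 (mem_product.2 ⟨mem_filter.2 ⟨mem_univ _, _, hsend⟩, mem_univ _⟩)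
  · rintro ⟨l, w, b⟩ - ⟨l', w', b'⟩ - h
    obtain ⟨hnode, rfl⟩ := Prod.ext_iff.1 h
    obtain ⟨rfl, hl⟩ := (node_inj l.2.le l'.2.le).1 hnode
    rw [Fin.ext hl]

theorem card_final_loc_le (S : A.Schedule (fftDAG (m + 1))) (P : Fin p) :
    #{x : BitVec (m + 1) × Bool | (packetRouting S).loc A.steps.length m x = P} ≤
      2 * A.maxOutputs (fftDAG (m + 1)) := by
  suffices h : _ ≤ #(({w | S.proc (node w (m + 1)) = P} : Finset (BitVec (m + 1))) ×ˢ
      (univ : Finset Bool)) by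
    rw [card_product, card_univ, Fintype.card_bool, mul_comm] at h
    exact h.trans (Nat.mul_le_mul_left 2 (card_le_maxOutputs S P))
  refine card_le_card_of_injOn (fun x => (headRow m x, x.2)) (fun x hx => ?_) ?_
  · have hend := (S.isTrajectory _ _ (fftDAG_arc_node m.lt_succ_self x)).eq_end _
      (S.time_lt_length _).le
    exact mem_coe.2 (mem_product.2
      ⟨mem_filter.2 ⟨mem_univ _, hend.symm.trans (mem_filter.1 hx).2⟩, mem_univ _⟩)
  · rintro ⟨w, b⟩ - ⟨w', b'⟩ - h
    obtain ⟨hrow, rfl⟩ := Prod.ext_iff.1 h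
    exact Prod.ext (headRow_left_injective m b hrow) rfl

theorem two_pow_le_exp_mul_pow (S : A.Schedule (fftDAG (m + 1)))
    (hp : (p : ℝ) ≤ 2 * 2 ^ (m + 1) / Real.exp 1) :
    (2 : ℝ) ^ (2 ^ (m + 1) * m) ≤
      Real.exp (2 * A.commComplexity * (p * Real.log (2 * 2 ^ (m + 1) / p))) *
        (2 * A.maxOutputs (fftDAG (m + 1))) ^ (2 * 2 ^ (m + 1)) := by
  have hX : Fintype.card (BitVec (m + 1) × Bool) = 2 * 2 ^ (m + 1) := by
    rw [Fintype.card_prod, card_bitVec, Fintype.card_bool, mul_comm]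
  have hS : Nat.card (Fin m → BitVec (m + 1) → Bool) = 2 ^ (2 ^ (m + 1) * m) := by
    simp [card_bitVec, pow_mul]
  have hdegree : ∑ t ∈ range A.steps.length, 2 * (A.superstep t).degree = 2 * A.commComplexity := by
    rw [← mul_sum, A.sum_superstep Superstep.degree, commComplexity]
  have h := (packetRouting S).natCard_settings_le (route_extendSetting_injective m.le_succ)
    (card_moves_le S) (by rw [hX]; simpa using hp) (fun x => S.time_lt_length (node x.1 m))
    (card_final_loc_le S)
  rw [hS, hX, hdegree] at h
  simpa using h

end Packets

theorem mul_log_le {A : Execution p (FFTNode k)} (S : A.Schedule (fftDAG k))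
    (hp : (p : ℝ) ≤ 2 * 2 ^ k / Real.exp 1) :
    2 ^ k * Real.log (2 ^ k / 2) ≤
      2 * A.commComplexity * (p * Real.log (2 * 2 ^ k / p)) +
        2 * 2 ^ k * Real.log (2 * A.maxOutputs (fftDAG k)) := by
  have hpq := (Nat.two_pow_pos k).trans_le (two_pow_le_mul_maxOutputs S)
  have hp1 : (1 : ℝ) ≤ p := Nat.one_le_cast.2 (Nat.pos_of_mul_pos_right hpq)
  have hq : (0 : ℝ) < A.maxOutputs (fftDAG k) := Nat.cast_pos.2 (Nat.pos_of_mul_pos_left hpq)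
  cases k with
  | zero =>
    have hexp := (le_div_iff₀ (Real.exp_pos 1)).1 (hp1.trans hp)
    linarith [Real.exp_one_gt_two]
  | succ m =>
    have h := Real.log_le_log (by positivity) (two_pow_le_exp_mul_pow S hp)
    rw [Real.log_mul (by positivity) (by positivity), Real.log_exp, Real.log_pow, Real.log_pow] at h
    rw [pow_succ (2 : ℝ) m, mul_div_cancel_right₀ _ two_ne_zero, Real.log_pow, ← pow_succ]
    push_cast at h
    linarith

section Bisection

/-- The row in which the path from row `w` of level `0` to row `w ^^^ x` of level `k` meets level
`l`. -/
def pathRow (x w : BitVec k) (l : ℕ) : BitVec k := w ^^^ (x.setWidth l).setWidth k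

theorem pathRow_zero (x w : BitVec k) : pathRow x w 0 = w := by
  simp [pathRow, BitVec.of_length_zero]

theorem pathRow_self (x w : BitVec k) : pathRow x w k = w ^^^ x := by
  simp [pathRow]

theorem headRow_pathRow (hl : l < k) (x w : BitVec k) :
    headRow l (pathRow x w l, x.getLsbD l) = pathRow x w (l + 1) := by
  refine BitVec.eq_of_getLsbD_eq fun i hi => ?_
  simp only [getLsbD_headRow hl, pathRow, BitVec.getLsbD_xor, BitVec.getLsbD_setWidth, hi,
    decide_true, Bool.true_and, Bool.xor_assoc]
  rcases lt_trichotomy i l with h | rfl | h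
  · simp [h, h.ne, h.trans l.lt_succ_self]
  · simp
  · simp [h.not_gt, h.ne', Nat.not_lt.2 (Nat.succ_le_of_lt h)]

variable {A : Execution p (FFTNode k)} {c : Fin p → Prop} [DecidablePred c] {H : ℕ}

theorem card_path_le (S : A.Schedule (fftDAG k))
    (hH : ∀ U : Finset (FFTNode k), (∀ u ∈ U, A.SendsAcross c u) → #U ≤ H) (x : BitVec k) :
    #{w | c (S.proc (node w 0)) ∧ ¬ c (S.proc (node (w ^^^ x) k))} ≤ H := by
  refine S.card_le_of_disjoint_paths (v := fun w l => node (pathRow x w l) l) (k := k)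
    (fun w _ l hl => ?_) (fun w _ w' _ l hl l' hl' h => ?_) (fun w hw => ?_) (fun w hw => ?_) hH
  · rw [← headRow_pathRow hl]
    exact fftDAG_arc_node hl (pathRow x w l, x.getLsbD l)
  · obtain ⟨hrow, rfl⟩ := (node_inj hl.le hl'.le).1 h
    exact (BitVec.xor_left_inj _).1 hrow
  · rw [pathRow_zero]
    exact (mem_filter.1 hw).2.1
  · rw [pathRow_self]
    exact (mem_filter.1 hw).2.2

theorem card_mul_card_le (S : A.Schedule (fftDAG k))
    (hH : ∀ U : Finset (FFTNode k), (∀ u ∈ U, A.SendsAcross c u) → #U ≤ H) :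
    #{w : BitVec k | c (S.proc (node w 0))} * #{w : BitVec k | ¬ c (S.proc (node w k))} ≤
      H * 2 ^ k := by
  rw [← card_product, ← card_bitVec, ← card_univ]
  refine card_le_mul_card_image_of_maps_to (f := fun y => y.1 ^^^ y.2) (fun _ _ => mem_univ _) H
    fun x _ => (card_le_card_of_injOn Prod.fst (fun y hy => ?_) ?_).trans (card_path_le S hH x)
  · obtain ⟨hmem, rfl⟩ := mem_filter.1 hy
    obtain ⟨hstart, hend⟩ := mem_product.1 hmem
    refine mem_coe.2 (mem_filter.2 ⟨mem_univ _, (mem_filter.1 hstart).2, ?_⟩)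
    rw [← BitVec.xor_assoc, BitVec.xor_self, BitVec.zero_xor]
    exact (mem_filter.1 hend).2
  · rintro ⟨w, v⟩ hwv ⟨w', v'⟩ hwv' (rfl : w = w')
    have hxor := (mem_filter.1 hwv).2.trans (mem_filter.1 hwv').2.symm
    exact Prod.ext rfl ((BitVec.xor_right_inj _).1 hxor)

end Bisection

theorem min_sub_half_le {n q x H : ℝ} (hx : 0 ≤ x) (hxn : x ≤ n) (hn : 0 < n)
    (hout : x * (n - q) ≤ H * n) (hin : (n - x) * q ≤ H * n) : min q (n - q) / 2 ≤ H := by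
  have hmul : n * min q (n - q) ≤ n * (2 * H) := by
    calc n * min q (n - q) = x * min q (n - q) + (n - x) * min q (n - q) := by ring
      _ ≤ x * (n - q) + (n - x) * q := by
          have := sub_nonneg.2 hxn
          gcongr
          exacts [min_le_right _ _, min_le_left _ _]
      _ ≤ n * (2 * H) := by linarith
  linarith [le_of_mul_le_mul_left hmul hn]

theorem min_maxOutputs_half_le {A : Execution p (FFTNode k)} (S : A.Schedule (fftDAG k)) :
    min (A.maxOutputs (fftDAG k) : ℝ) (2 ^ k - A.maxOutputs (fftDAG k)) / 2 ≤
      A.commComplexity := by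
  obtain ⟨P, hP⟩ := exists_card_eq_maxOutputs S
  have hcompl : ∀ l, (#{w : BitVec k | ¬ S.proc (node w l) = P} : ℝ) =
      2 ^ k - #{w : BitVec k | S.proc (node w l) = P} := fun l => by
    have h := card_filter_add_card_filter_not (s := univ)
      fun w : BitVec k => S.proc (node w l) = P
    rw [card_univ, card_bitVec] at h
    exact eq_sub_of_add_eq' (by exact_mod_cast h)
  have hout := card_mul_card_le S fun _ => card_le_commComplexity_of_sendsAcross_eq (P := P)
  have hin := card_mul_card_le S fun _ => card_le_commComplexity_of_sendsAcross_ne (P := P)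
  simp only [not_not] at hin
  rify at hout hin
  rw [hcompl, hP] at hout hin
  refine min_sub_half_le (x := #{w : BitVec k | S.proc (node w 0) = P}) (Nat.cast_nonneg _) ?_
    (by positivity) hout hin
  exact sub_nonneg.1 (hcompl 0 ▸ Nat.cast_nonneg _)

end FFT

section Numerics

theorem mul_logb_div_mul_logb {b : ℝ} (hb : 1 < b) (c d x y : ℝ) :
    c * Real.logb b x / (d * Real.logb b y) = c * Real.log x / (d * Real.log y) := by
  rw [Real.logb, Real.logb, ← mul_div_assoc, ← mul_div_assoc,
    div_div_div_cancel_right₀ (Real.log_pos hb).ne']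

theorem log_mul_div_log_le {y v : ℝ} (hy : Real.exp 1 ≤ y) (hv : Real.log y ≤ v) :
    Real.log (y * (v / Real.log y)) ≤ v := by
  have hy0 : 0 < y := (Real.exp_pos 1).trans_le hy
  have hlog : 1 ≤ Real.log y := (Real.le_log_iff_exp_le hy0).2 hy
  have hlog0 : 0 < Real.log y := one_pos.trans_le hlog
  have hv0 : 0 < v := hlog0.trans_le hv
  calc Real.log (y * (v / Real.log y)) = Real.log y + Real.log (v / Real.log y) :=
        Real.log_mul hy0.ne' (div_pos hv0 hlog0).ne'
    _ ≤ Real.log y + (v / Real.log y - 1) := by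
        gcongr
        exact Real.log_le_sub_one_of_pos (div_pos hv0 hlog0)
    _ = Real.log y + (v - Real.log y) / Real.log y := by rw [sub_div, div_self hlog0.ne']
    _ ≤ Real.log y + (v - Real.log y) := by
        gcongr
        exact div_le_self (sub_nonneg.2 hv) hlog
    _ = v := by ring

variable {n p q H : ℝ}

theorem mul_log_div_le_half (hp0 : 0 < p) (hn : 0 < n) (hq0 : 0 < q) (hp : Real.exp 1 ≤ 2 * n / p)
    (hcount : n * Real.log (n / 2) ≤
      2 * H * (p * Real.log (2 * n / p)) + 2 * n * Real.log (2 * q)) :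
    n * Real.log (n / (8 * q ^ 2)) / (4 * p * Real.log (2 * n / p)) ≤ H / 2 := by
  have hL : 0 < Real.log (2 * n / p) := Real.log_pos ((Real.one_lt_exp_iff.2 one_pos).trans_le hp)
  have hlog : Real.log (n / (8 * q ^ 2)) = Real.log (n / 2) - 2 * Real.log (2 * q) := by
    rw [show n / (8 * q ^ 2) = n / 2 / (2 * q) ^ 2 by ring,
      Real.log_div (by positivity) (by positivity), Real.log_pow, Nat.cast_ofNat]
  rw [div_le_iff₀ (by positivity), hlog]
  linarith

theorem log_two_mul_le (hp0 : 0 < p) (hn : 0 < n) (hq0 : 0 < q) (hp : Real.exp 1 ≤ 2 * n / p)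
    (hpq : n ≤ p * q) (h : 4 * (p * Real.log (2 * n / p)) * q ≤ n * Real.log (n / 2)) :
    Real.log (2 * q) ≤ Real.log (n / 2) / 4 := by
  have hL : 0 < Real.log (2 * n / p) := Real.log_pos ((Real.one_lt_exp_iff.2 one_pos).trans_le hp)
  have hLM : Real.log (2 * n / p) ≤ Real.log (n / 2) / 4 := by
    have : n * (4 * Real.log (2 * n / p)) ≤ n * Real.log (n / 2) :=
      calc n * (4 * Real.log (2 * n / p)) ≤ p * q * (4 * Real.log (2 * n / p)) := by gcongr
        _ = 4 * (p * Real.log (2 * n / p)) * q := by ring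
        _ ≤ n * Real.log (n / 2) := h
    linarith [le_of_mul_le_mul_left this hn]
  refine (Real.log_le_log (by positivity) ?_).trans (log_mul_div_log_le hp hLM)
  rw [div_mul_div_comm, le_div_iff₀ (by positivity)]
  linarith

theorem mul_log_div_lt (hp0 : 0 < p) (hn : 0 < n) (hq0 : 0 < q) (hp : Real.exp 1 ≤ 2 * n / p)
    (hpq : n ≤ p * q)
    (hcount : n * Real.log (n / 2) ≤
      2 * H * (p * Real.log (2 * n / p)) + 2 * n * Real.log (2 * q)) (hH : q / 2 ≤ H) :
    n * Real.log (n / 2) / (8 * p * Real.log (2 * n / p)) < H := by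
  have hL : 0 < Real.log (2 * n / p) := Real.log_pos ((Real.one_lt_exp_iff.2 one_pos).trans_le hp)
  have hpL : 0 < p * Real.log (2 * n / p) := mul_pos hp0 hL
  have hpLq : 4 * (p * Real.log (2 * n / p)) * q ≤ 8 * (p * Real.log (2 * n / p)) * H := by
    nlinarith
  have hpLH : 0 < p * Real.log (2 * n / p) * H := mul_pos hpL (by linarith)
  rw [div_lt_iff₀ (by positivity)]
  rcases lt_or_ge (n * Real.log (n / 2)) (4 * (p * Real.log (2 * n / p)) * q) with h | h
  · linarith
  · have hlog : 2 * n * Real.log (2 * q) ≤ 2 * n * (Real.log (n / 2) / 4) := by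
      gcongr
      exact log_two_mul_le hp0 hn hq0 hp hpq h
    linarith

end Numerics

theorem theorem3_general (k n p q : ℕ) (hn : n = 2 ^ k)
    (hp : (p : ℝ) ≤ 2 * (n : ℝ) / Real.exp 1)
    (A : BSP.Execution p (FFTNode k))
    (hA : A.EvaluatesWithoutRecomputation (fftDAG k))
    (hq : q = A.maxOutputs (fftDAG k)) :
    (A.commComplexity : ℝ) ≥
        (n : ℝ) * Real.logb 2 ((n : ℝ) / (8 * (q : ℝ) ^ 2)) /
            (4 * (p : ℝ) * Real.logb 2 (2 * (n : ℝ) / (p : ℝ))) +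
          min (q : ℝ) ((n : ℝ) - (q : ℝ)) / 4 ∧
      ((q : ℝ) ≤ (n : ℝ) / 2 →
        (A.commComplexity : ℝ) >
          (n : ℝ) * Real.logb 2 ((n : ℝ) / 2) /
            (8 * (p : ℝ) * Real.logb 2 (2 * (n : ℝ) / (p : ℝ)))) := by
  obtain ⟨S⟩ := hA.nonempty_schedule
  have hn2 : (2 : ℝ) ^ k = n := by rw [hn, Nat.cast_pow, Nat.cast_ofNat]
  have hn0 : 0 < n := hn ▸ Nat.two_pow_pos k
  have hpq : n ≤ p * q := hn ▸ hq ▸ FFT.two_pow_le_mul_maxOutputs S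
  have hp0 : 0 < p := Nat.pos_of_mul_pos_right (hn0.trans_le hpq)
  have hq0 : 0 < q := Nat.pos_of_mul_pos_left (hn0.trans_le hpq)
  have hcut := FFT.min_maxOutputs_half_le S
  have hcount := FFT.mul_log_le S (hn2 ▸ hp)
  rw [hn2, ← hq] at hcut hcount
  rify at hn0 hpq hp0 hq0
  have he : Real.exp 1 ≤ 2 * n / p := (le_div_comm₀ hp0 (Real.exp_pos 1)).1 hp
  rw [mul_logb_div_mul_logb one_lt_two, mul_logb_div_mul_logb one_lt_two]
  refine ⟨?_, fun hqn => mul_log_div_lt hp0 hn0 hq0 he hpq hcount ?_⟩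
  · linarith [mul_log_div_le_half hp0 hn0 hq0 he hcount]
  · rwa [min_eq_left (by linarith)] at hcut

theorem theorem3 (k n p q : ℕ) (hn : n = 2 ^ k)
    (hp : (p : ℝ) ≤ 2 * (n : ℝ) / Real.exp 1)
    (A : BSP.Execution p (FFTNode k))
    (hA : A.EvaluatesWithoutRecomputation (fftDAG k))
    (hin : A.InputsAtUniqueProcessor (fftDAG k))
    (hq : q = A.maxOutputs (fftDAG k)) :
    (A.commComplexity : ℝ) ≥
        (n : ℝ) * Real.logb 2 ((n : ℝ) / (8 * (q : ℝ) ^ 2)) /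
            (4 * (p : ℝ) * Real.logb 2 (2 * (n : ℝ) / (p : ℝ))) +
          min (q : ℝ) ((n : ℝ) - (q : ℝ)) / 4 ∧
      ((q : ℝ) ≤ (n : ℝ) / 2 →
        (A.commComplexity : ℝ) >
          (n : ℝ) * Real.logb 2 ((n : ℝ) / 2) /
            (8 * (p : ℝ) * Real.logb 2 (2 * (n : ℝ) / (p : ℝ)))) :=
  theorem3_general k n p q hn hp A hA hq
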